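/- Let $R$ be a semiprimary ring (an associative unital ring whose Jacobson radical $J$ is nilpotent and for which $R/J$ is semisimple artinian), and let $n\ge 0$ be an integer with $J^n=0$. Let $R\text{-}\mathrm{Mod}$ be the category of left $R$-modules. An ideal $\mathcal I$ of this category assigns to every pair $(X,Y)$ of modules a subgroup $\mathcal I(X,Y)\subseteq \mathrm{Hom}_R(X,Y)$ such that $fgh$ belongs to $\mathcal I$ whenever $g$ belongs to $\mathcal I$ and $f,h$ are morphisms for which the composition is defined. The product $\mathcal I\mathcal J$ of two ideals is the smallest ideal that contains all compositions $ij$ with $i\in\mathcal I$ and $j\in\mathcal J$; further, $\mathcal I^0=\mathrm{Hom}$ and $\mathcal I^{m+1}=\mathcal I^m\mathcal I$. Call a morphism $f:X\to Y$ of left $R$-modules phantom if for every finitely presented left $R$-module $C$ and every morphism $c:C\to X$, the composition $fc$ factors through a projective module. The phantom morphisms form an ideal $\Phi$ of $R\text{-}\mathrm{Mod}$. Then $$\Phi^n=\langle R\text{-}\mathrm{Proj}\rangle,$$ where $\langle R\text{-}\mathrm{Proj}\rangle$ is the ideal generated by the identity morphisms of the projective left $R$-modules, that is, the ideal of all morphisms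 that factor through a projective left $R$-module. -/

import Mathlib

open CategoryTheory

universe v u

/-- An ideal of a preadditive category: an additive subbifunctor of `Hom(-, -)`, that is, a choice
of a subgroup of every Hom-group that is stable under composition on both sides with arbitrary
morphisms. -/
@[ext]
structure HomIdeal (C : Type*) [Category C] [Preadditive C] where
  /-- The subgroup of those morphisms `X ⟶ Y` that belong to the ideal. -/
  hom (X Y : C) : AddSubgroup (X ⟶ Y)
  comp_mem' : ∀ {W X Y Z : C} (h : W ⟶ X) (g : X ⟶ Y) (f : Y ⟶ Z),
    g ∈ hom X Y → h ≫ g ≫ f ∈ hom W Z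

namespace HomIdeal

variable {C : Type*} [Category C] [Preadditive C]

/-- The ideal of all morphisms. -/
instance : One (HomIdeal C) where
  one :=
    { hom := fun _ _ => ⊤
      comp_mem' := fun _ _ _ _ => AddSubgroup.mem_top _ }

/-- The smallest ideal that contains a given class of morphisms. -/
def span (M : MorphismProperty C) : HomIdeal C where
  hom X Y :=
    { carrier := {f | ∀ I : HomIdeal C,
        (∀ (A B : C) (m : A ⟶ B), M m → m ∈ I.hom A B) → f ∈ I.hom X Y}
      zero_mem' := fun I _ => (I.hom X Y).zero_mem
      add_mem' := fun hf hg I hI => (I.hom X Y).add_mem (hf I hI) (hg I hI)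
      neg_mem' := fun hf I hI => (I.hom X Y).neg_mem (hf I hI) }
  comp_mem' := fun h g f hg I hI => I.comp_mem' h g f (hg I hI)

/-- The product `I * J`: the ideal generated by all compositions of a morphism `j` of `J`
followed by a morphism `i` of `I`. -/
instance : Mul (HomIdeal C) where
  mul I J := span fun X Y f =>
    ∃ (Z : C) (j : X ⟶ Z) (i : Z ⟶ Y), j ∈ J.hom X Z ∧ i ∈ I.hom Z Y ∧ j ≫ i = f

/-- Finite powers of an ideal; the zeroth power is the ideal of all morphisms. -/
def npow (I : HomIdeal C) : ℕ → HomIdeal C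
  | 0 => 1
  | n + 1 => npow I n * I

instance : Pow (HomIdeal C) ℕ where
  pow := npow

/-- The class of identity morphisms of the objects of a given class. -/
inductive IsIdentityOf (P : ObjectProperty C) : ∀ ⦃X Y : C⦄, (X ⟶ Y) → Prop
  | id (A : C) (hA : P A) : IsIdentityOf P (𝟙 A)

/-- The ideal generated by the identity morphisms of the objects of a given class. -/
def ofObjects (P : ObjectProperty C) : HomIdeal C :=
  span fun _ _ f => IsIdentityOf P f

end HomIdeal

/-- A morphism of left `R`-modules factors through a projective module. -/
def FactorsThroughProjective {R : Type u} [Ring R] {X Y : ModuleCat.{v} R} (f : X ⟶ Y) : Prop :=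
  ∃ (P : ModuleCat.{v} R) (a : X ⟶ P) (b : P ⟶ Y), Module.Projective R P ∧ a ≫ b = f

section

variable {R : Type u} [Ring R]

theorem FactorsThroughProjective.comp {W X Y Z : ModuleCat.{v} R} {g : X ⟶ Y}
    (hg : FactorsThroughProjective g) (h : W ⟶ X) (f : Y ⟶ Z) :
    FactorsThroughProjective (h ≫ g ≫ f) := by
  obtain ⟨P, a, b, hP, rfl⟩ := hg
  exact ⟨P, h ≫ a, b ≫ f, hP, by simp⟩

theorem FactorsThroughProjective.zero (X Y : ModuleCat.{v} R) :
    FactorsThroughProjective (0 : X ⟶ Y) :=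
  ⟨ModuleCat.of R PUnit.{v + 1}, 0, 0, by
    change Module.Projective R PUnit.{v + 1}
    infer_instance, by simp⟩

theorem FactorsThroughProjective.neg {X Y : ModuleCat.{v} R} {f : X ⟶ Y}
    (hf : FactorsThroughProjective f) : FactorsThroughProjective (-f) := by
  obtain ⟨P, a, b, hP, rfl⟩ := hf
  exact ⟨P, a, -b, hP, by simp⟩

theorem FactorsThroughProjective.add {X Y : ModuleCat.{v} R} {f g : X ⟶ Y}
    (hf : FactorsThroughProjective f) (hg : FactorsThroughProjective g) :
    FactorsThroughProjective (f + g) := by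
  obtain ⟨P, a, b, hP, rfl⟩ := hf
  obtain ⟨Q, c, d, hQ, rfl⟩ := hg
  refine ⟨ModuleCat.of R (P × Q), ModuleCat.ofHom (a.hom.prod c.hom),
    ModuleCat.ofHom (b.hom.coprod d.hom), ?_, ?_⟩
  · change Module.Projective R (P × Q)
    infer_instance
  · ext x
    simp

end

/-- A morphism `f : X ⟶ Y` of left `R`-modules is phantom if for every finitely presented module
`K` and every `c : K ⟶ X` the composition of `c` with `f` factors through a projective module. -/
def IsPhantom {R : Type u} [Ring R] {X Y : ModuleCat.{v} R} (f : X ⟶ Y) : Prop :=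
  ∀ (K : ModuleCat.{v} R), Module.FinitePresentation R K →
    ∀ c : K ⟶ X, FactorsThroughProjective (c ≫ f)

/-- The ideal of phantom morphisms in the category of left `R`-modules. -/
def phantomIdeal (R : Type u) [Ring R] : HomIdeal (ModuleCat.{v} R) where
  hom X Y :=
    { carrier := {f | IsPhantom f}
      zero_mem' := fun K _ c => by
        simpa using FactorsThroughProjective.zero K Y
      add_mem' := fun hf hg K hK c => by
        simpa using (hf K hK c).add (hg K hK c)
      neg_mem' := fun hf K hK c => by
        simpa using (hf K hK c).neg }
  comp_mem' := fun h g f hg K hK c => by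
    simpa using (hg K hK (c ≫ h)).comp (𝟙 K) f

/-- The ideal generated by the projective left `R`-modules. -/
def projectiveIdeal (R : Type u) [Ring R] : HomIdeal (ModuleCat.{v} R) :=
  HomIdeal.ofObjects fun P => Module.Projective R P

/-- The ideal generated by the projective modules consists of the morphisms that factor through
a projective module. -/
theorem mem_projectiveIdeal_iff {R : Type u} [Ring R] {X Y : ModuleCat.{v} R} (f : X ⟶ Y) :
    f ∈ (projectiveIdeal R).hom X Y ↔ FactorsThroughProjective f := by
  constructor
  · intro hf
    refine hf
      { hom := fun A B =>
          { carrier := {g | FactorsThroughProjective g}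
            zero_mem' := FactorsThroughProjective.zero A B
            add_mem' := fun h₁ h₂ => h₁.add h₂
            neg_mem' := fun h₁ => h₁.neg }
        comp_mem' := fun h g k hg => hg.comp h k } ?_
    intro A B m hm
    cases hm with
    | id hA => exact ⟨_, 𝟙 _, 𝟙 _, hA, by simp⟩
  · rintro ⟨P, a, b, hP, rfl⟩ I hI
    simpa using I.comp_mem' a (𝟙 P) b (hI P P (𝟙 P) (.id P hP))

/-!
Write `J` for the Jacobson radical. Say that `f : X ⟶ Y` *lifts to order* `k` if it lifts along
every epimorphism `B ⟶ Y` whose kernel `K` satisfies `J ^ k • K = 0`; equivalently, `Ext¹(f, K) = 0`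
for every module `K` with `J ^ k • K = 0`. These morphisms form an ideal `HomIdeal.lifting R k`, and
the theorem follows from three facts about it.

* A phantom morphism lifts to order `1` (`IsPhantom.exists_lift`). Let `J • K = 0`. The pullback
  `0 ⟶ K ⟶ E ⟶ X ⟶ 0` of the epimorphism along `f` has the lifting property for finitely presented
  modules, so it is pure and hence `K ∩ J • E = J • K = 0`. Thus `K` embeds in the semisimple module
  `E ⧸ J • E`, and a complement of its image there splits the sequence.
* Orders add up under composition (`HomIdeal.comp_mem_lifting`): for `f` followed by `g`, with `g` of
  order `k` and `f` of order `l`, first lift `g` along `B ⧸ J ^ k • K ⟶ Y`, whose kernel is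
  annihilated by `J ^ k`, and then lift `f` along the pullback of `B ⟶ B ⧸ J ^ k • K`, whose kernel
  is `J ^ k • K` and so is annihilated by `J ^ l` as soon as `J ^ (l + k) • K = 0`.
* If `J ^ n = 0`, a morphism that lifts to order `n` lifts along a free cover of its target.

So an `n`-fold composition of phantom morphisms factors through a projective module. The other
inclusion holds since the identity of a projective module is phantom and idempotent.
-/

/-! ### Pure extensions by modules annihilated by the radical -/

theorem Submodule.exists_sum_of_mem_ideal_smul_top {R : Type*} {M : Type*} [Ring R]
    [AddCommGroup M] [Module R M] (I : Ideal R) {x : M} (hx : x ∈ I • (⊤ : Submodule R M)) :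
    ∃ (ι : Type) (_ : Fintype ι) (r : ι → R) (m : ι → M),
      (∀ i, r i ∈ I) ∧ ∑ i, r i • m i = x := by
  refine Submodule.smul_induction_on hx
    (fun r hr m _ => ⟨Unit, inferInstance, fun _ => r, fun _ => m, fun _ => hr, by simp⟩) ?_
  rintro _ _ ⟨ι, _, r, m, hr, rfl⟩ ⟨κ, _, s, l, hs, rfl⟩
  exact ⟨ι ⊕ κ, inferInstance, Sum.elim r s, Sum.elim m l, by simp [hr, hs], by simp⟩

/-- An extension splits if its kernel meets the radical trivially, because the kernel then embeds
in a semisimple quotient of the middle term. -/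
theorem LinearMap.exists_rightInverse_of_disjoint_jacobson_smul_top {R : Type*} [Ring R]
    [IsSemiprimaryRing R] {E X : Type*} [AddCommGroup E] [Module R E] [AddCommGroup X] [Module R X]
    (q : E →ₗ[R] X) (hq : Function.Surjective q)
    (hd : Disjoint (LinearMap.ker q) (Ring.jacobson R • (⊤ : Submodule R E))) :
    ∃ s : X →ₗ[R] E, q ∘ₗ s = LinearMap.id := by
  set JE : Submodule R E := Ring.jacobson R • ⊤
  have hss : IsSemisimpleModule R (E ⧸ JE) := by
    have ht : Module.IsTorsionBySet R (E ⧸ JE) (Ring.jacobson R : Set R) :=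
      Module.isTorsionBySet_quotient_ideal_smul E (Ring.jacobson R)
    let := ht.module
    exact ht.isSemisimpleModule_iff.mp inferInstance
  obtain ⟨N, hN⟩ := exists_isCompl ((LinearMap.ker q).map JE.mkQ)
  have hinj : Function.Injective (q ∘ₗ (N.comap JE.mkQ).subtype) := by
    rw [← LinearMap.ker_eq_bot, LinearMap.ker_eq_bot']
    rintro ⟨e, he⟩ hqe
    have h0 : JE.mkQ e = 0 :=
      Submodule.disjoint_def.mp hN.disjoint _ (Submodule.mem_map_of_mem hqe) he
    exact Subtype.ext (Submodule.disjoint_def.mp hd e hqe ((Submodule.Quotient.mk_eq_zero _).mp h0))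
  have hsurj : Function.Surjective (q ∘ₗ (N.comap JE.mkQ).subtype) := by
    intro x
    obtain ⟨e, rfl⟩ := hq x
    obtain ⟨_, ⟨k, hk, rfl⟩, n, hn, hkn⟩ :=
      Submodule.mem_sup.mp (hN.sup_eq_top ▸ Submodule.mem_top : JE.mkQ e ∈ _)
    refine ⟨⟨e - k, ?_⟩, ?_⟩
    · rw [Submodule.mem_comap, map_sub, ← hkn]
      simpa using hn
    · have : q k = 0 := hk
      simp [this]
  refine ⟨(N.comap JE.mkQ).subtype ∘ₗ (LinearEquiv.ofBijective _ ⟨hinj, hsurj⟩).symm, ?_⟩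
  ext x
  exact (LinearEquiv.ofBijective _ ⟨hinj, hsurj⟩).apply_symm_apply x

/-- If morphisms from finitely presented modules lift along `q`, then the extension `q` is pure:
its kernel `K` satisfies `K ∩ I • E = I • K`. This is the case `I • K = 0`. -/
theorem LinearMap.disjoint_ker_smul_top_of_lifts {R : Type u} [Ring R] {E X : Type*}
    [AddCommGroup E] [Module R E] [AddCommGroup X] [Module R X] (q : E →ₗ[R] X) (I : Ideal R)
    (hI : I • LinearMap.ker q = ⊥)
    (hlift : ∀ (C : Type u) [AddCommGroup C] [Module R C] [Module.FinitePresentation R C]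
      (c : C →ₗ[R] X), ∃ d : C →ₗ[R] E, q ∘ₗ d = c) :
    Disjoint (LinearMap.ker q) (I • (⊤ : Submodule R E)) := by
  classical
  rw [Submodule.disjoint_def]
  intro x hx hxI
  obtain ⟨ι, _, r, e, hr, rfl⟩ := Submodule.exists_sum_of_mem_ideal_smul_top I hxI
  -- The relation `∑ r i • q (e i) = 0` in `X` is a map from a module with one relation `r`;
  -- lifting it moves the `e i` by elements of the kernel to a solution of the relation in `E`.
  have hle : R ∙ r ≤ LinearMap.ker (Fintype.linearCombination R fun i => q (e i)) := by
    rw [Submodule.span_singleton_le_iff_mem, LinearMap.mem_ker]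
    simpa [Fintype.linearCombination_apply] using hx
  have : Module.FinitePresentation R ((ι → R) ⧸ R ∙ r) :=
    Module.finitePresentation_of_surjective (R ∙ r).mkQ (Submodule.mkQ_surjective _)
      (by simpa using Submodule.fg_span_singleton r)
  obtain ⟨d, hd⟩ := hlift _ ((R ∙ r).liftQ _ hle)
  let e' : ι → E := fun i => d ((R ∙ r).mkQ (Pi.single i 1))
  have he' : ∑ i, r i • e' i = 0 := by
    have hr0 : (R ∙ r).mkQ r = 0 :=
      (Submodule.Quotient.mk_eq_zero _).mpr (Submodule.mem_span_singleton_self r)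
    have hsum : r = ∑ i, r i • (Pi.single i 1 : ι → R) := by
      ext j
      simp [Finset.sum_apply, Pi.single_apply]
    calc ∑ i, r i • e' i = d ((R ∙ r).mkQ (∑ i, r i • (Pi.single i 1 : ι → R))) := by
          simp only [map_sum, map_smul, e']
      _ = 0 := by rw [← hsum, hr0, map_zero]
  have hk : ∀ i, e i - e' i ∈ LinearMap.ker q := by
    intro i
    have h := LinearMap.congr_fun hd ((R ∙ r).mkQ (Pi.single i 1))
    rw [LinearMap.comp_apply, Submodule.mkQ_apply, Submodule.liftQ_apply,
      Fintype.linearCombination_apply_single, one_smul] at h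
    rw [LinearMap.mem_ker, map_sub, sub_eq_zero]
    exact h.symm
  have hmem : ∑ i, r i • (e i - e' i) ∈ I • LinearMap.ker q :=
    Submodule.sum_mem _ fun i _ => Submodule.smul_mem_smul (hr i) (hk i)
  rw [hI, Submodule.mem_bot] at hmem
  simpa [smul_sub, Finset.sum_sub_distrib, he'] using hmem

/-! ### Phantom morphisms lift along extensions killed by the radical -/

theorem FactorsThroughProjective.exists_lift {R : Type u} [Ring R] {X Y : ModuleCat.{v} R}
    {f : X ⟶ Y} (hf : FactorsThroughProjective f) {B : Type*} [AddCommGroup B] [Module R B]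
    (p : B →ₗ[R] Y) (hp : Function.Surjective p) : ∃ g : X →ₗ[R] B, p ∘ₗ g = f.hom := by
  obtain ⟨P, a, b, hP, rfl⟩ := hf
  obtain ⟨l, hl⟩ := Module.projective_lifting_property p b.hom hp
  exact ⟨l ∘ₗ a.hom, by rw [← LinearMap.comp_assoc, hl, ModuleCat.hom_comp]⟩

/-- A module homomorphism lifts along an epimorphism iff the pullback of that epimorphism splits. -/
theorem LinearMap.exists_lift_of_pullback_splits {R : Type*} [Ring R] {B X Y : Type*}
    [AddCommGroup B] [Module R B] [AddCommGroup X] [Module R X] [AddCommGroup Y] [Module R Y]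
    (f : X →ₗ[R] Y) (p : B →ₗ[R] Y)
    (h : ∃ s : X →ₗ[R] LinearMap.eqLocus (f ∘ₗ LinearMap.fst R X B) (p ∘ₗ LinearMap.snd R X B),
      (LinearMap.fst R X B ∘ₗ Submodule.subtype _) ∘ₗ s = LinearMap.id) :
    ∃ g : X →ₗ[R] B, p ∘ₗ g = f := by
  obtain ⟨s, hs⟩ := h
  refine ⟨LinearMap.snd R X B ∘ₗ Submodule.subtype _ ∘ₗ s, LinearMap.ext fun x => ?_⟩
  have h1 : (s x).1.1 = x := LinearMap.congr_fun hs x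
  have h2 : f (s x).1.1 = p (s x).1.2 := (s x).2
  rw [h1] at h2
  exact h2.symm

theorem LinearMap.smul_ker_pullback_fst_eq_bot {R : Type*} [Ring R] {B X Y : Type*}
    [AddCommGroup B] [Module R B] [AddCommGroup X] [Module R X] [AddCommGroup Y] [Module R Y]
    (f : X →ₗ[R] Y) (p : B →ₗ[R] Y) (I : Ideal R) (h : I • LinearMap.ker p = ⊥) :
    I • LinearMap.ker (LinearMap.fst R X B ∘ₗ
      (LinearMap.eqLocus (f ∘ₗ LinearMap.fst R X B) (p ∘ₗ LinearMap.snd R X B)).subtype) = ⊥ := by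
  rw [eq_bot_iff, Submodule.smul_le]
  rintro r hr ⟨⟨x, b⟩, hxb⟩ hx
  obtain rfl : x = 0 := hx
  have hb : p b = 0 := by
    have : f 0 = p b := hxb
    rw [← this, map_zero]
  have hrb : r • b ∈ I • LinearMap.ker p := Submodule.smul_mem_smul hr hb
  rw [h, Submodule.mem_bot] at hrb
  rw [Submodule.mem_bot]
  exact Subtype.ext (Prod.ext (smul_zero r) hrb)

theorem LinearMap.pullback_fst_surjective {R : Type*} [Ring R] {B X Y : Type*}
    [AddCommGroup B] [Module R B] [AddCommGroup X] [Module R X] [AddCommGroup Y] [Module R Y]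
    (f : X →ₗ[R] Y) (p : B →ₗ[R] Y) (hp : Function.Surjective p) :
    Function.Surjective (LinearMap.fst R X B ∘ₗ
      (LinearMap.eqLocus (f ∘ₗ LinearMap.fst R X B) (p ∘ₗ LinearMap.snd R X B)).subtype) := by
  intro x
  obtain ⟨b, hb⟩ := hp (f x)
  exact ⟨⟨(x, b), hb.symm⟩, rfl⟩

theorem IsPhantom.exists_lift {R : Type u} [Ring R] [IsSemiprimaryRing R]
    {X Y : ModuleCat.{max u v} R} {f : X ⟶ Y} (hf : IsPhantom f) {B : Type*} [AddCommGroup B]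
    [Module R B] (p : B →ₗ[R] Y) (hp : Function.Surjective p)
    (hK : Ring.jacobson R • LinearMap.ker p = ⊥) : ∃ g : X →ₗ[R] B, p ∘ₗ g = f.hom := by
  refine LinearMap.exists_lift_of_pullback_splits f.hom p <|
    LinearMap.exists_rightInverse_of_disjoint_jacobson_smul_top _
      (LinearMap.pullback_fst_surjective f.hom p hp) <|
    LinearMap.disjoint_ker_smul_top_of_lifts _ _
      (LinearMap.smul_ker_pullback_fst_eq_bot f.hom p _ hK) ?_
  intro C _ _ _ c
  obtain ⟨d, hd⟩ := (hf (ModuleCat.of R (ULift.{v} C)) (.of_equiv ULift.moduleEquiv.symm)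
    (ModuleCat.ofHom (c ∘ₗ ULift.moduleEquiv.toLinearMap))).exists_lift p hp
  refine ⟨(c.prod (d ∘ₗ ULift.moduleEquiv.symm.toLinearMap)).codRestrict _ fun x => ?_, rfl⟩
  exact (LinearMap.congr_fun hd (ULift.up x)).symm

/-! ### The ideals of morphisms that lift to a given order -/

namespace HomIdeal

/-- The ideal of the morphisms `f : X ⟶ Y` that lift along every surjection onto `Y` whose kernel
is annihilated by the `k`-th power of the Jacobson radical. -/
def lifting (R : Type u) [Ring R] (k : ℕ) : HomIdeal (ModuleCat.{v} R) where
  hom X Y :=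
    { carrier := {f | ∀ (B : ModuleCat.{v} R) (p : B →ₗ[R] Y), Function.Surjective p →
        Ring.jacobson R ^ k • LinearMap.ker p = ⊥ → ∃ g : X →ₗ[R] B, p ∘ₗ g = f.hom}
      zero_mem' := fun _ _ _ _ => ⟨0, by simp⟩
      add_mem' := fun hf hg B p hp hk => by
        obtain ⟨a, ha⟩ := hf B p hp hk
        obtain ⟨b, hb⟩ := hg B p hp hk
        exact ⟨a + b, by rw [LinearMap.comp_add, ha, hb, ModuleCat.hom_add]⟩
      neg_mem' := fun hf B p hp hk => by
        obtain ⟨a, ha⟩ := hf B p hp hk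
        exact ⟨-a, by rw [LinearMap.comp_neg, ha, ModuleCat.hom_neg]⟩ }
  comp_mem' := fun {W X Y Z} h g f hg B p hp hk => by
    obtain ⟨a, ha⟩ := hg
      (ModuleCat.of R (LinearMap.eqLocus (f.hom ∘ₗ LinearMap.fst R Y B)
        (p ∘ₗ LinearMap.snd R Y B)))
      (LinearMap.fst R Y B ∘ₗ Submodule.subtype _)
      (LinearMap.pullback_fst_surjective f.hom p hp)
      (LinearMap.smul_ker_pullback_fst_eq_bot f.hom p _ hk)
    refine ⟨LinearMap.snd R Y B ∘ₗ Submodule.subtype _ ∘ₗ a ∘ₗ h.hom, LinearMap.ext fun w => ?_⟩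
    have h1 : (a (h.hom w)).1.1 = g.hom (h.hom w) := LinearMap.congr_fun ha (h.hom w)
    have h2 : f.hom (a (h.hom w)).1.1 = p (a (h.hom w)).1.2 := (a (h.hom w)).2
    rw [h1] at h2
    exact h2.symm

theorem comp_mem_lifting {R : Type u} [Ring R] {k l : ℕ} {X Y Z : ModuleCat.{v} R}
    {f : X ⟶ Y} {g : Y ⟶ Z} (hf : f ∈ (lifting R l).hom X Y) (hg : g ∈ (lifting R k).hom Y Z) :
    f ≫ g ∈ (lifting R (l + k)).hom X Z := by
  intro B p hp hK
  set N : Submodule R B := Ring.jacobson R ^ k • LinearMap.ker p with hN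
  have hNp : N ≤ LinearMap.ker p := Submodule.smul_le_right
  obtain ⟨a, ha⟩ := hg (ModuleCat.of R (B ⧸ N)) (N.liftQ p hNp)
    (fun z => by
      obtain ⟨b, rfl⟩ := hp z
      exact ⟨N.mkQ b, rfl⟩)
    (by
      rw [Submodule.ker_liftQ, ← Submodule.map_smul'', ← hN, ← LinearMap.le_ker_iff_map,
        Submodule.ker_mkQ])
  -- `lifting R l` is an ideal, so `f` followed by `a` lifts along `B ⟶ B ⧸ N` itself.
  have hfa : f ≫ (ModuleCat.ofHom a : Y ⟶ ModuleCat.of R (B ⧸ N)) ∈ (lifting R l).hom _ _ := by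
    simpa using (lifting R l).comp_mem' (𝟙 X) f (ModuleCat.ofHom a) hf
  obtain ⟨b, hb⟩ := hfa B N.mkQ N.mkQ_surjective (by
    rw [Submodule.ker_mkQ, hN, ← Submodule.mul_smul, ← Ideal.IsTwoSided.pow_add, hK])
  refine ⟨b, ?_⟩
  calc p ∘ₗ b = N.liftQ p hNp ∘ₗ N.mkQ ∘ₗ b := by
        rw [← LinearMap.comp_assoc, Submodule.liftQ_mkQ]
    _ = (N.liftQ p hNp ∘ₗ a) ∘ₗ f.hom := by rw [hb]; rfl
    _ = (f ≫ g).hom := by rw [ha, ModuleCat.hom_comp]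

theorem mem_lifting_zero {R : Type u} [Ring R] {X Y : ModuleCat.{v} R} (f : X ⟶ Y) :
    f ∈ (lifting R 0).hom X Y := by
  intro B p hp hK
  have hinj : Function.Injective p := by
    rw [← LinearMap.ker_eq_bot, ← hK, Submodule.pow_zero, Ideal.one_eq_top, Submodule.top_smul]
  refine ⟨(LinearEquiv.ofBijective p ⟨hinj, hp⟩).symm ∘ₗ f.hom, LinearMap.ext fun x => ?_⟩
  exact (LinearEquiv.ofBijective p ⟨hinj, hp⟩).apply_symm_apply (f.hom x)

theorem phantomIdeal_pow_le_lifting (R : Type u) [Ring R] [IsSemiprimaryRing R] (n : ℕ)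
    {X Y : ModuleCat.{max u v} R} {f : X ⟶ Y}
    (hf : f ∈ (phantomIdeal R ^ n : HomIdeal (ModuleCat.{max u v} R)).hom X Y) :
    f ∈ (lifting R n).hom X Y := by
  induction n generalizing X Y with
  | zero => exact mem_lifting_zero f
  | succ n ih =>
    refine hf (lifting R (n + 1)) ?_
    rintro A B _ ⟨Z, j, i, hj, hi, rfl⟩
    have hj1 : j ∈ (lifting R 1).hom A Z := fun D p hp hK =>
      IsPhantom.exists_lift.{v} hj p hp (by rwa [Submodule.pow_one] at hK)
    rw [add_comm]
    exact comp_mem_lifting hj1 (ih hi)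

theorem factorsThroughProjective_of_mem_lifting {R : Type u} [Ring R] {n : ℕ}
    (hn : Ring.jacobson R ^ n = ⊥) {X Y : ModuleCat.{max u v} R} {f : X ⟶ Y}
    (hf : f ∈ (lifting R n).hom X Y) : FactorsThroughProjective f := by
  obtain ⟨g, hg⟩ := hf (ModuleCat.of R (Y →₀ R)) (Finsupp.linearCombination R id)
    (Finsupp.linearCombination_id_surjective R Y) (by rw [hn, Submodule.bot_smul])
  refine ⟨ModuleCat.of R (Y →₀ R), ModuleCat.ofHom g,
    ModuleCat.ofHom (Finsupp.linearCombination R id), ?_, ?_⟩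
  · change Module.Projective R (Y →₀ R)
    infer_instance
  · exact ModuleCat.hom_ext hg

/-! ### Powers of the phantom ideal -/

theorem id_mem_phantomIdeal_pow {R : Type u} [Ring R] (P : ModuleCat.{v} R)
    (hP : Module.Projective R P) (n : ℕ) :
    𝟙 P ∈ (phantomIdeal R ^ n : HomIdeal (ModuleCat.{v} R)).hom P P := by
  induction n with
  | zero => exact AddSubgroup.mem_top _
  | succ n ih =>
    exact fun I hI => hI P P (𝟙 P)
      ⟨P, 𝟙 P, 𝟙 P, fun K _ c => ⟨P, c, 𝟙 P, hP, rfl⟩, ih, Category.comp_id _⟩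

end HomIdeal

theorem mainTheorem1 (R : Type u) [Ring R] [IsSemiprimaryRing R] (n : ℕ)
    (hn : Ring.jacobson R ^ n = ⊥) :
    (phantomIdeal R ^ n : HomIdeal (ModuleCat.{max u v} R)) = projectiveIdeal R := by
  ext X Y f
  constructor
  · intro hf
    rw [mem_projectiveIdeal_iff]
    exact HomIdeal.factorsThroughProjective_of_mem_lifting.{v} hn
      (HomIdeal.phantomIdeal_pow_le_lifting.{v} R n hf)
  · intro hf
    refine hf _ ?_
    intro A B m hm
    cases hm with
    | id hA => exact HomIdeal.id_mem_phantomIdeal_pow A hA n
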